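/- Let $A_0$ be a nonnegative self-adjoint operator in a complex Hilbert space $\mathfrak H$ (inner product $(\cdot,\cdot)$ linear in the first argument). Put $\mathfrak H_1(A_0)=\mathcal D(A_0^{1/2})=\mathcal D((A_0+I)^{1/2})$ and let $\mathfrak H_{-1}(A_0)\subset\mathfrak H_{-2}(A_0)$ be the completions of $\mathfrak H$ in the norms $\|(A_0+I)^{-1/2}u\|$ and $\|(A_0+I)^{-1}u\|$, respectively. Let $(\mathbb A_0+I)^{-1}:\mathfrak H_{-2}(A_0)\to\mathfrak H$ be the continuous extension of $(A_0+I)^{-1}$, and put $\langle\psi,u\rangle=((A_0+I)u,(\mathbb A_0+I)^{-1}\psi)$ for $\psi\in\mathfrak H_{-2}(A_0)$, $u\in\mathcal D(A_0)$. Let $\psi_1,\dots,\psi_n\in\mathfrak H_{-2}(A_0)$ be linearly independent with $\operatorname{span}\{\psi_j\}\cap\mathfrak H=\{0\}$, let $h_j=(\mathbb A_0+I)^{-1}\psi_j$, and let $A_{\rm sym}$ be the restriction of $A_0$ to $\{u\in\mathcal D(A_0):\langle\psi_j,u\rangle=0,\ 1\le j\le n\}$, a closed densely defined nonnegative symmetric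 operator. Every $f\in\mathcal D(A_{\rm sym}^*)$ has a unique representation $f=u+\sum_{p=1}^n\alpha_ph_p$ with $u\in\mathcal D(A_0)$, $\alpha_p\in\mathbb C$. For a Hermitian matrix $\mathbf R=(r_{jp})_{j,p=1}^n$ put $$\langle\psi_j^{\rm ex},f\rangle=\langle\psi_j,u\rangle+\sum_{p=1}^n\alpha_p r_{jp},\qquad f\in\mathcal D(A_{\rm sym}^*).$$ The Hermitian matrix $\mathbf R$ is called admissible if, whenever $\psi=\sum_j c_j\psi_j$ $(c_j\in\mathbb C)$ belongs to $\mathfrak H_{-1}(A_0)$, the element $h=(\mathbb A_0+I)^{-1}\psi$ of $\mathfrak H_1(A_0)$ satisfies $$\sum_{j=1}^n\overline{c_j}\,\langle\psi_j^{\rm ex},f\rangle=((A_0+I)^{1/2}f,(A_0+I)^{1/2}h)\quad\text{for all } f\in\mathcal D(A_{\rm sym}^*)\cap\mathfrak H_1(A_0).$$ An operator is called admissible for the regularization of $A_0+\sum_{i,j=1}^n b_{ij}\langle\psi_j,\cdot\rangle\psi_i$ if, for some admissible $\mathbf R$, it is the restriction of $A_{\rm sym}^*$ to $\{f\in\mathcal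 D(A_{\rm sym}^*):\langle\psi_j^{\rm ex},f\rangle=0,\ 1\le j\le n\}$ (this does not depend on the coefficients $b_{ij}$). **Theorem.** A self-adjoint extension $\widetilde A$ of $A_{\rm sym}$ is admissible for the regularization if and only if $\widetilde A$ is transversal to $A_0$, i.e. $\mathcal D(A_0)+\mathcal D(\widetilde A)=\mathcal D(A_{\rm sym}^*)$, and $$\mathcal D(\widetilde A)\cap\mathfrak H_1(A_0)\subset\mathcal D(A_F),$$ where $A_F$ is the Friedrichs extension of $A_{\rm sym}$. -/

import Mathlib

open Filter Topology
open scoped Matrix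

noncomputable section

namespace SingularPerturbation

variable {H : Type*} [NormedAddCommGroup H] [InnerProductSpace ℂ H]

/-! ### Nonnegative operators and the Friedrichs extension -/

/-- `(S u, u) ≥ 0` for all `u` in the domain (the imaginary part vanishes for symmetric `S`). -/
def IsNonneg (S : H →ₗ.[ℂ] H) : Prop :=
  ∀ u : S.domain, 0 ≤ (inner ℂ (u : H) (S u)).re

/-- The domain of the closure of the form `(S u, v)`, `u, v ∈ 𝒟(S)`, of a nonnegative symmetric
operator: all limits in `H` of sequences in `𝒟(S)` that are Cauchy for the form. -/
def formDomain (S : H →ₗ.[ℂ] H) (hS : IsNonneg S) : Submodule ℂ H where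
  carrier := {f | ∃ u : ℕ → S.domain, Tendsto (fun k => (u k : H)) atTop (𝓝 f) ∧
    Tendsto (fun p : ℕ × ℕ =>
      (inner ℂ ((u p.1 - u p.2 : S.domain) : H) (S (u p.1 - u p.2))).re) atTop (𝓝 0)}
  zero_mem' := ⟨fun _ => 0, by simp, by simp⟩
  add_mem' := by
    rintro f g ⟨u, hu, hu'⟩ ⟨v, hv, hv'⟩
    refine ⟨fun k => u k + v k, by simpa using hu.add hv, ?_⟩
    have hlim : Tendsto (fun p : ℕ × ℕ =>
        2 * (inner ℂ ((u p.1 - u p.2 : S.domain) : H) (S (u p.1 - u p.2))).re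
        + 2 * (inner ℂ ((v p.1 - v p.2 : S.domain) : H) (S (v p.1 - v p.2))).re)
        atTop (𝓝 0) := by
      simpa using (hu'.const_mul 2).add (hv'.const_mul 2)
    refine squeeze_zero (fun p => hS _) (fun p => ?_) hlim
    have e : u p.1 + v p.1 - (u p.2 + v p.2) = (u p.1 - u p.2) + (v p.1 - v p.2) := by abel
    rw [e]
    generalize u p.1 - u p.2 = x
    generalize v p.1 - v p.2 = y
    have h := hS (x - y)
    simp only [LinearPMap.map_add, LinearPMap.map_sub, Submodule.coe_add, Submodule.coe_sub,
      inner_add_left, inner_add_right, inner_sub_left, inner_sub_right, Complex.add_re,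
      Complex.sub_re] at h ⊢
    linarith
  smul_mem' := by
    rintro c f ⟨u, hu, hu'⟩
    refine ⟨fun k => c • u k, by simpa using hu.const_smul c, ?_⟩
    have e : ∀ p : ℕ × ℕ,
        (inner ℂ ((c • u p.1 - c • u p.2 : S.domain) : H) (S (c • u p.1 - c • u p.2))).re
        = ‖c‖ ^ 2 * (inner ℂ ((u p.1 - u p.2 : S.domain) : H) (S (u p.1 - u p.2))).re := by
      intro p
      rw [← smul_sub, LinearPMap.map_smul, Submodule.coe_smul, inner_smul_left,
        inner_smul_right, ← mul_assoc, Complex.conj_mul', ← Complex.ofReal_pow,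
        Complex.re_ofReal_mul]
    simp only [e]
    simpa using hu'.const_mul (‖c‖ ^ 2)

/-- The Friedrichs extension of a densely defined nonnegative symmetric operator `S`: the operator
associated with the closure of the form of `S`, that is, the restriction of `S†` to those elements
of `𝒟(S†)` that lie in the domain of the closed form. -/
def friedrichs [CompleteSpace H] (S : H →ₗ.[ℂ] H) (hS : IsNonneg S) : H →ₗ.[ℂ] H :=
  S.adjoint.domRestrict (formDomain S hS)

/-- Transversality of two extensions `A`, `B` of `S`: `𝒟(A) + 𝒟(B) = 𝒟(S†)`. -/
def Transversal [CompleteSpace H] (S A B : H →ₗ.[ℂ] H) : Prop :=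
  A.domain ⊔ B.domain = S.adjoint.domain

/-! ### The resolvent `(A + I)⁻¹` and its square root -/

/-- The map `u ↦ (A + I) u` on `𝒟(A)`. -/
def shift (A : H →ₗ.[ℂ] H) : A.domain →ₗ[ℂ] H := A.toFun + A.domain.subtype

theorem shift_apply (A : H →ₗ.[ℂ] H) (u : A.domain) : shift A u = A u + u := rfl

variable [CompleteSpace H]

/-- Nonnegative self-adjoint operators. -/
structure IsNonnegSelfAdjoint (A : H →ₗ.[ℂ] H) : Prop where
  selfAdjoint : IsSelfAdjoint A
  nonneg : IsNonneg A

variable {A : H →ₗ.[ℂ] H}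

theorem norm_le_norm_shift (hA : IsNonnegSelfAdjoint A) (u : A.domain) :
    ‖(u : H)‖ ≤ ‖shift A u‖ := by
  have h1 : ‖(u : H)‖ * ‖(u : H)‖ ≤ ‖(u : H)‖ * ‖shift A u‖ := by
    calc ‖(u : H)‖ * ‖(u : H)‖ = (inner ℂ (u : H) (u : H)).re :=
          (inner_self_eq_norm_mul_norm (𝕜 := ℂ) (u : H)).symm
      _ ≤ (inner ℂ (u : H) (shift A u)).re := by
          rw [shift_apply, inner_add_right, Complex.add_re]
          linarith [hA.nonneg u]
      _ ≤ ‖inner ℂ (u : H) (shift A u)‖ := Complex.re_le_norm _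
      _ ≤ _ := norm_inner_le_norm _ _
  rcases (norm_nonneg (u : H)).eq_or_lt with h | h
  · rw [← h]; exact norm_nonneg _
  · exact le_of_mul_le_mul_left h1 h

theorem shift_injective (hA : IsNonnegSelfAdjoint A) : Function.Injective (shift A) := by
  rw [← LinearMap.ker_eq_bot, LinearMap.ker_eq_bot']
  intro u hu
  have := norm_le_norm_shift hA u
  rw [hu, norm_zero] at this
  exact Subtype.ext (norm_le_zero_iff.mp this)

theorem shift_surjective (hA : IsNonnegSelfAdjoint A) : Function.Surjective (shift A) := by
  have hadj := LinearPMap.isSelfAdjoint_def.mp hA.selfAdjoint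
  have hdense := hA.selfAdjoint.dense_domain
  have hcl : IsClosed ((LinearMap.range (shift A) : Submodule ℂ H) : Set H) := by
    have hgr : IsClosed (A.graph : Set (H × H)) := hA.selfAdjoint.isClosed
    have : CompleteSpace A.graph := hgr.completeSpace_coe
    let g : A.graph →L[ℂ] H :=
      (ContinuousLinearMap.snd ℂ H H + ContinuousLinearMap.fst ℂ H H).comp A.graph.subtypeL
    have hb : ∀ p : A.graph, ‖p‖ ≤ (2 : NNReal) * ‖g p‖ := by
      rintro ⟨⟨x, y⟩, hp⟩
      obtain ⟨u, hu, hy⟩ := A.mem_graph_iff.mp hp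
      simp only at hu hy
      have hg : g ⟨(x, y), hp⟩ = shift A u := by
        simp [g, shift_apply, hu, hy]
      have h1 := norm_le_norm_shift hA u
      have h2 : ‖y‖ ≤ ‖shift A u‖ + ‖(u : H)‖ := by
        have : y = shift A u - u := by rw [shift_apply, hy]; abel
        rw [this]; exact norm_sub_le _ _
      rw [hg, Submodule.coe_norm, Prod.norm_def]
      have h3 := norm_nonneg (shift A u)
      simp only [NNReal.coe_ofNat, ← hu]
      exact max_le (by linarith) (by linarith)
    have hr := (AddMonoidHomClass.antilipschitz_of_bound g hb).isClosed_range g.uniformContinuous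
    convert hr using 1
    ext z
    constructor
    · rintro ⟨u, rfl⟩
      exact ⟨⟨_, A.mem_graph u⟩, rfl⟩
    · rintro ⟨⟨⟨x, y⟩, hp⟩, rfl⟩
      obtain ⟨u, hu, hy⟩ := A.mem_graph_iff.mp hp
      exact ⟨u, by simp only at hu hy; simp [g, shift_apply, hu, hy]⟩
  have horth : (LinearMap.range (shift A))ᗮ = ⊥ := by
    rw [Submodule.eq_bot_iff]
    intro v hv
    have hv' : ∀ u : A.domain, inner ℂ (-v) (u : H) = inner ℂ v (A u) := by
      intro u
      have h := Submodule.inner_left_of_mem_orthogonal (LinearMap.mem_range_self (shift A) u) hv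
      rw [shift_apply, inner_add_right] at h
      rw [inner_neg_left]
      exact (eq_neg_of_add_eq_zero_left h).symm
    have hmem : v ∈ A.adjoint.domain := A.mem_adjoint_domain_of_exists v ⟨-v, hv'⟩
    have happ : A.adjoint ⟨v, hmem⟩ = -v := LinearPMap.adjoint_apply_eq hdense _ hv'
    have hmem' : v ∈ A.domain := by rw [← hadj]; exact hmem
    have hle : A.adjoint ≤ A := hadj.le
    have happ' : A ⟨v, hmem'⟩ = -v := by
      rw [← happ]; exact (hle.2 (x := ⟨v, hmem⟩) (y := ⟨v, hmem'⟩) rfl).symm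
    have h0 := norm_le_norm_shift hA ⟨v, hmem'⟩
    rw [shift_apply, happ'] at h0
    simpa using h0
  have : CompleteSpace (LinearMap.range (shift A)) := hcl.completeSpace_coe
  exact LinearMap.range_eq_top.mp ((Submodule.orthogonal_eq_bot_iff).mp horth)

/-- The resolvent `(A + I)⁻¹` as an everywhere defined bounded operator on `H`. -/
def resolvent (hA : IsNonnegSelfAdjoint A) : H →L[ℂ] H :=
  (A.domain.subtype ∘ₗ
    (LinearEquiv.ofBijective (shift A)
      ⟨shift_injective hA, shift_surjective hA⟩).symm.toLinearMap).mkContinuous 1 (by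
    intro f
    obtain ⟨u, rfl⟩ := shift_surjective hA f
    have h : (LinearEquiv.ofBijective (shift A)
        ⟨shift_injective hA, shift_surjective hA⟩).symm (shift A u) = u :=
      LinearEquiv.symm_apply_apply
        (LinearEquiv.ofBijective (shift A) ⟨shift_injective hA, shift_surjective hA⟩) u
    simpa [h] using norm_le_norm_shift hA u)

theorem resolvent_shift (hA : IsNonnegSelfAdjoint A) (u : A.domain) :
    resolvent hA (shift A u) = u :=
  congrArg Subtype.val (LinearEquiv.symm_apply_apply
    (LinearEquiv.ofBijective (shift A) ⟨shift_injective hA, shift_surjective hA⟩) u)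

theorem resolvent_nonneg (hA : IsNonnegSelfAdjoint A) : 0 ≤ resolvent hA := by
  rw [ContinuousLinearMap.nonneg_iff_isPositive]
  refine ⟨fun f g => ?_, fun f => ?_⟩
  · obtain ⟨u, rfl⟩ := shift_surjective hA f
    obtain ⟨v, rfl⟩ := shift_surjective hA g
    have hadj := LinearPMap.isSelfAdjoint_def.mp hA.selfAdjoint
    have h := LinearPMap.adjoint_isFormalAdjoint hA.selfAdjoint.dense_domain
    rw [hadj] at h
    have h' : inner ℂ (A u) (v : H) = inner ℂ (u : H) (A v) := h u v
    change inner ℂ (resolvent hA _) _ = inner ℂ _ (resolvent hA _)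
    rw [resolvent_shift, resolvent_shift, shift_apply, shift_apply, inner_add_left,
      inner_add_right, h']
  · obtain ⟨u, rfl⟩ := shift_surjective hA f
    change 0 ≤ (inner ℂ (resolvent hA _) _).re
    rw [resolvent_shift, shift_apply, inner_add_right, Complex.add_re]
    have h2 : 0 ≤ (inner ℂ (u : H) (u : H)).re := inner_self_nonneg (𝕜 := ℂ)
    linarith [hA.nonneg u]

/-- The bounded operator `(A + I)^(-1/2)`, the nonnegative square root of the resolvent. -/
def sqrtResolvent (hA : IsNonnegSelfAdjoint A) : H →L[ℂ] H := CFC.sqrt (resolvent hA)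

/-- The operator `(A + I)^(1/2)`, the inverse of the injective operator `(A + I)^(-1/2)`. -/
def sqrtShift (hA : IsNonnegSelfAdjoint A) : H →ₗ.[ℂ] H :=
  ((sqrtResolvent hA).toLinearMap.toPMap ⊤).inverse

/-! ### The scale of Hilbert spaces associated with `A` -/

/-- The space `ℌ₁(A) = 𝒟(A^(1/2)) = 𝒟((A + I)^(1/2))`. -/
def HOne (hA : IsNonnegSelfAdjoint A) : Submodule ℂ H := (sqrtShift hA).domain

/-- The inner product `((A + I)^(1/2) f, (A + I)^(1/2) h)` of `ℌ₁(A)`, linear in `f`. -/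
def innerOne (hA : IsNonnegSelfAdjoint A) (f h : HOne hA) : ℂ :=
  inner ℂ (sqrtShift hA h) (sqrtShift hA f)

/-- The space `H` with the norm `u ↦ ‖T u‖`. -/
def Renormed (_T : H →L[ℂ] H) : Type _ := H

instance (T : H →L[ℂ] H) : AddCommGroup (Renormed T) := inferInstanceAs (AddCommGroup H)

instance (T : H →L[ℂ] H) : Module ℂ (Renormed T) := inferInstanceAs (Module ℂ H)

/-- The operator `T` as a linear map on the renormed space. -/
def Renormed.op (T : H →L[ℂ] H) : Renormed T →ₗ[ℂ] H := T.toLinearMap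

instance (T : H →L[ℂ] H) : SeminormedAddCommGroup (Renormed T) :=
  SeminormedAddCommGroup.induced _ H (Renormed.op T)

instance (T : H →L[ℂ] H) : NormedSpace ℂ (Renormed T) :=
  NormedSpace.induced ℂ (Renormed T) H (Renormed.op T)

/-- The completion of `H` with respect to the norm `u ↦ ‖T u‖`. -/
abbrev RenormedCompletion (T : H →L[ℂ] H) : Type _ := UniformSpace.Completion (Renormed T)

/-- The canonical map from `H` to its completion with respect to `u ↦ ‖T u‖`. -/
def toRenormedCompletion (T : H →L[ℂ] H) : H →ₗ[ℂ] RenormedCompletion T where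
  toFun u := ((show Renormed T from u : Renormed T) : RenormedCompletion T)
  map_add' u v := UniformSpace.Completion.coe_add (α := Renormed T) u v
  map_smul' c u := UniformSpace.Completion.coe_smul (X := Renormed T) c u

/-- `ℌ₋₁(A)`: the completion of `H` with respect to `‖(A + I)^(-1/2) u‖`. -/
abbrev HMinusOne (hA : IsNonnegSelfAdjoint A) : Type _ := RenormedCompletion (sqrtResolvent hA)

/-- `ℌ₋₂(A)`: the completion of `H` with respect to `‖(A + I)⁻¹ u‖`. -/
abbrev HMinusTwo (hA : IsNonnegSelfAdjoint A) : Type _ := RenormedCompletion (resolvent hA)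

/-- `H` as a subspace of `ℌ₋₂(A)`. -/
def rangeH (hA : IsNonnegSelfAdjoint A) : Submodule ℂ (HMinusTwo hA) :=
  LinearMap.range (toRenormedCompletion (resolvent hA))

/-- `ℌ₋₁(A)` as a subspace of `ℌ₋₂(A)`: the range of the continuous extension to `ℌ₋₁(A)` of the
embedding of `H` into `ℌ₋₂(A)`. -/
def rangeHMinusOne (hA : IsNonnegSelfAdjoint A) : Submodule ℂ (HMinusTwo hA) :=
  LinearMap.range ((toRenormedCompletion (resolvent hA)).extendOfNorm
    (toRenormedCompletion (sqrtResolvent hA))).toLinearMap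

/-- The extended resolvent `(𝔸 + I)⁻¹ : ℌ₋₂(A) → H`, the continuous extension of `(A + I)⁻¹`. -/
def extResolvent (hA : IsNonnegSelfAdjoint A) : HMinusTwo hA →L[ℂ] H :=
  (resolvent hA).toLinearMap.extendOfNorm (toRenormedCompletion (resolvent hA))

/-- The pairing `⟨ψ, u⟩ = ((A + I) u, (𝔸 + I)⁻¹ ψ)` for `u ∈ 𝒟(A)`; it is linear in `u` and
conjugate linear in `ψ`. -/
def pairing (hA : IsNonnegSelfAdjoint A) (ψ : HMinusTwo hA) : A.domain →ₗ[ℂ] ℂ :=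
  (innerₛₗ ℂ (extResolvent hA ψ)).comp (shift A)

/-! ### The symmetric operator and admissible matrices and operators -/

variable {n : ℕ}

/-- The operator `A_sym`: the restriction of `A` to the `u ∈ 𝒟(A)` with `⟨ψ_j, u⟩ = 0`
for all `j`. -/
def symOp (hA : IsNonnegSelfAdjoint A) (ψ : Fin n → HMinusTwo hA) : H →ₗ.[ℂ] H :=
  A.domRestrict ((⨅ j, LinearMap.ker (pairing hA (ψ j))).map A.domain.subtype)

theorem symOp_le (hA : IsNonnegSelfAdjoint A) (ψ : Fin n → HMinusTwo hA) : symOp hA ψ ≤ A :=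
  LinearPMap.domRestrict_le

theorem symOp_nonneg (hA : IsNonnegSelfAdjoint A) (ψ : Fin n → HMinusTwo hA) :
    IsNonneg (symOp hA ψ) := by
  intro u
  have h := hA.nonneg ⟨u, (symOp_le hA ψ).1 u.2⟩
  rwa [← (symOp_le hA ψ).2 (x := u) (y := ⟨u, (symOp_le hA ψ).1 u.2⟩) rfl] at h

/-- The vectors `h_j = (𝔸 + I)⁻¹ ψ_j`, a basis of `ker (A_sym† + I)`. -/
def defectVec (hA : IsNonnegSelfAdjoint A) (ψ : Fin n → HMinusTwo hA) (j : Fin n) : H :=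
  extResolvent hA (ψ j)

/-- `f = u + ∑ p, α_p h_p`. Under the standing assumptions every `f ∈ 𝒟(A_sym†)` has exactly one
such representation with `u ∈ 𝒟(A)` and `α ∈ ℂⁿ`. -/
def Decomposes (hA : IsNonnegSelfAdjoint A) (ψ : Fin n → HMinusTwo hA)
    (f : H) (u : A.domain) (α : Fin n → ℂ) : Prop :=
  f = u + ∑ p, α p • defectVec hA ψ p

/-- The value `⟨ψ_j^ex, f⟩ = ⟨ψ_j, u⟩ + ∑ p, α_p r_{jp}` at `f = u + ∑ p, α_p h_p`
of the functional extended by means of the matrix `R = (r_{jp})`. -/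
def extPairing (hA : IsNonnegSelfAdjoint A) (ψ : Fin n → HMinusTwo hA)
    (R : Matrix (Fin n) (Fin n) ℂ) (j : Fin n) (u : A.domain) (α : Fin n → ℂ) : ℂ :=
  pairing hA (ψ j) u + ∑ p, α p * R j p

/-- Admissible matrices: Hermitian matrices `R` such that, whenever `ψ = ∑ j, c_j ψ_j` belongs to
`ℌ₋₁(A)`, the extended functional `⟨ψ^ex, ·⟩ = ∑ j, conj c_j ⟨ψ_j^ex, ·⟩` coincides on
`𝒟(A_sym†) ∩ ℌ₁(A)` with the continuous extension `f ↦ ((A + I)^(1/2) f, (A + I)^(1/2) h)`,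
`h = (𝔸 + I)⁻¹ ψ ∈ ℌ₁(A)`, of `⟨ψ, ·⟩`. The coefficients are conjugated because the pairing is
conjugate linear in `ψ`. -/
def IsAdmissibleMatrix (hA : IsNonnegSelfAdjoint A) (ψ : Fin n → HMinusTwo hA)
    (R : Matrix (Fin n) (Fin n) ℂ) : Prop :=
  R.IsHermitian ∧
    ∀ c : Fin n → ℂ, ∑ j, c j • ψ j ∈ rangeHMinusOne hA →
      ∃ hh : extResolvent hA (∑ j, c j • ψ j) ∈ HOne hA,
        ∀ (f : H) (_ : f ∈ (symOp hA ψ).adjoint.domain) (hf : f ∈ HOne hA)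
          (u : A.domain) (α : Fin n → ℂ), Decomposes hA ψ f u α →
          ∑ j, star (c j) * extPairing hA ψ R j u α = innerOne hA ⟨f, hf⟩ ⟨_, hh⟩

/-- `B` is the operator determined by the matrix `R`: the restriction of `A_sym†` to the set of all
`f ∈ 𝒟(A_sym†)` with `⟨ψ_j^ex, f⟩ = 0` for all `j`. -/
def IsOperatorOfMatrix (hA : IsNonnegSelfAdjoint A) (ψ : Fin n → HMinusTwo hA)
    (R : Matrix (Fin n) (Fin n) ℂ) (B : H →ₗ.[ℂ] H) : Prop :=
  B ≤ (symOp hA ψ).adjoint ∧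
    ∀ f : H, f ∈ B.domain ↔ f ∈ (symOp hA ψ).adjoint.domain ∧
      ∃ (u : A.domain) (α : Fin n → ℂ), Decomposes hA ψ f u α ∧
        ∀ j, extPairing hA ψ R j u α = 0

/-- Admissible operators: the operators determined by admissible matrices. -/
def IsAdmissibleOperator (hA : IsNonnegSelfAdjoint A) (ψ : Fin n → HMinusTwo hA)
    (B : H →ₗ.[ℂ] H) : Prop :=
  ∃ R : Matrix (Fin n) (Fin n) ℂ, IsAdmissibleMatrix hA ψ R ∧ IsOperatorOfMatrix hA ψ R B

end SingularPerturbation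

end

open SingularPerturbation

namespace SingularPerturbation

section

variable {H : Type*} [NormedAddCommGroup H] [InnerProductSpace ℂ H]

/-! ### Completions with respect to `u ↦ ‖T u‖` -/

/-! Let N be the span of the h_j. Since N is finite-dimensional and (A_sym + I) maps 𝒟(A_sym) onto
Nᗮ, one gets 𝒟(A_sym†) = 𝒟(A) + N, and the problem becomes linear algebra in the coordinates (⟨ψ_j,
u⟩, α).

The map u ↦ (⟨ψ_j, u⟩)_j is onto ℂⁿ (`exists_pairing_eq`), so for any matrix R each f ∈ 𝒟(A_sym†)
can be moved by some v ∈ 𝒟(A) into the domain that R determines; this is transversality. Conversely,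
transversality yields v_p ∈ 𝒟(A) with v_p + h_p ∈ 𝒟(B), and r_{jp} = -⟨ψ_j, v_p⟩ recovers B; Green's
identity makes R Hermitian.

For the form condition, ψ ∈ ℌ₋₁ exactly when h ∈ ℌ₁ (`mem_rangeHMinusOne_iff`), and the form domain
of A_sym is the ℌ₁-orthogonal complement of N ∩ ℌ₁ (`mem_formDomain_symOp_iff`). Both sides of the
admissibility identity are linear in f and agree on 𝒟(A), so it need only be tested on 𝒟(B) ∩ ℌ₁.
There the left side vanishes, and the identity says that 𝒟(B) ∩ ℌ₁ is ℌ₁-orthogonal to N ∩ ℌ₁, that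
is, contained in 𝒟(A_F). -/

theorem norm_toRenormedCompletion (T : H →L[ℂ] H) (u : H) :
    ‖toRenormedCompletion T u‖ = ‖T u‖ :=
  UniformSpace.Completion.norm_coe (E := Renormed T) u

theorem denseRange_toRenormedCompletion (T : H →L[ℂ] H) :
    DenseRange (toRenormedCompletion T) :=
  UniformSpace.Completion.denseRange_coe (α := Renormed T)

variable [CompleteSpace H]

/-- The continuous extension of `T` to the completion with respect to `u ↦ ‖T u‖`. -/
noncomputable def extendOp (T : H →L[ℂ] H) : RenormedCompletion T →L[ℂ] H :=
  T.toLinearMap.extendOfNorm (toRenormedCompletion T)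

theorem extendOp_toRenormedCompletion (T : H →L[ℂ] H) (u : H) :
    extendOp T (toRenormedCompletion T u) = T u :=
  LinearMap.extendOfNorm_eq (denseRange_toRenormedCompletion T)
    ⟨1, fun x => by rw [one_mul, norm_toRenormedCompletion]; rfl⟩ u

theorem norm_extendOp (T : H →L[ℂ] H) (φ : RenormedCompletion T) : ‖extendOp T φ‖ = ‖φ‖ := by
  refine (denseRange_toRenormedCompletion T).induction_on (p := fun φ => ‖extendOp T φ‖ = ‖φ‖) φ
    (isClosed_eq (extendOp T).continuous.norm continuous_norm) fun u => ?_
  rw [extendOp_toRenormedCompletion, norm_toRenormedCompletion]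

theorem extendOp_injective (T : H →L[ℂ] H) : Function.Injective (extendOp T) :=
  (AddMonoidHomClass.isometry_of_norm (extendOp T) (norm_extendOp T)).injective

theorem extendOp_surjective (T : H →L[ℂ] H) (hT : DenseRange T) :
    Function.Surjective (extendOp T) := by
  have hc : IsClosed (Set.range (extendOp T)) :=
    (AddMonoidHomClass.isometry_of_norm (extendOp T) (norm_extendOp T)).isClosedEmbedding
      |>.isClosed_range
  have hd : Dense (Set.range (extendOp T)) := by
    refine hT.mono ?_
    rintro _ ⟨u, rfl⟩
    exact ⟨_, extendOp_toRenormedCompletion T u⟩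
  intro x
  have := hd x
  rwa [hc.closure_eq] at this

/-! ### The resolvent and its square root -/

variable {A : H →ₗ.[ℂ] H} (hA : IsNonnegSelfAdjoint A)

theorem sqrtResolvent_sqrtResolvent (x : H) :
    sqrtResolvent hA (sqrtResolvent hA x) = resolvent hA x := by
  have h := CFC.sqrt_mul_sqrt_self (resolvent hA) (resolvent_nonneg hA)
  exact congrArg (fun B : H →L[ℂ] H => B x) h

theorem inner_sqrtResolvent_left (x y : H) :
    inner ℂ (sqrtResolvent hA x) y = inner ℂ x (sqrtResolvent hA y) :=
  (((ContinuousLinearMap.nonneg_iff_isPositive _).mp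
    (CFC.sqrt_nonneg (resolvent hA))).isSymmetric) x y

theorem inner_resolvent_left (x y : H) :
    inner ℂ (resolvent hA x) y = inner ℂ x (resolvent hA y) :=
  (((ContinuousLinearMap.nonneg_iff_isPositive _).mp (resolvent_nonneg hA)).isSymmetric) x y

theorem exists_shift_resolvent (x : H) :
    ∃ u : A.domain, (u : H) = resolvent hA x ∧ shift A u = x := by
  obtain ⟨u, rfl⟩ := shift_surjective hA x
  exact ⟨u, (resolvent_shift hA u).symm, rfl⟩

theorem resolvent_injective : Function.Injective (resolvent hA) := by
  refine (injective_iff_map_eq_zero _).mpr fun x hx => ?_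
  obtain ⟨u, hu, rfl⟩ := exists_shift_resolvent hA x
  have : u = 0 := Subtype.ext (hu.trans hx)
  rw [this, map_zero]

theorem sqrtResolvent_injective : Function.Injective (sqrtResolvent hA) := by
  refine (injective_iff_map_eq_zero _).mpr fun x hx => resolvent_injective hA ?_
  rw [← sqrtResolvent_sqrtResolvent, hx, map_zero, map_zero]

theorem denseRange_sqrtResolvent : DenseRange (sqrtResolvent hA) := by
  have h : (LinearMap.range (sqrtResolvent hA).toLinearMap)ᗮ = ⊥ := by
    rw [Submodule.eq_bot_iff]
    intro v hv
    apply sqrtResolvent_injective hA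
    rw [map_zero, ← inner_self_eq_zero (𝕜 := ℂ), inner_sqrtResolvent_left]
    exact Submodule.inner_left_of_mem_orthogonal
      (LinearMap.mem_range_self (sqrtResolvent hA).toLinearMap _) hv
  exact Submodule.dense_iff_topologicalClosure_eq_top.mpr
    ((Submodule.topologicalClosure_eq_top_iff).mpr h)

theorem mem_HOne {f : H} : f ∈ HOne hA ↔ ∃ g, sqrtResolvent hA g = f := by
  rw [HOne, sqrtShift, LinearPMap.inverse_domain]
  constructor
  · rintro ⟨⟨g, _⟩, rfl⟩
    exact ⟨g, rfl⟩
  · rintro ⟨g, rfl⟩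
    exact ⟨⟨g, Submodule.mem_top⟩, rfl⟩

theorem sqrtShift_eq (g : H) (f : HOne hA) (h : sqrtResolvent hA g = f) :
    sqrtShift hA f = g := by
  refine LinearPMap.inverse_apply_eq (f := (sqrtResolvent hA).toLinearMap.toPMap ⊤) ?_
    (x := ⟨g, Submodule.mem_top⟩) h
  rw [LinearMap.ker_eq_bot]
  intro x y hxy
  exact Subtype.ext (sqrtResolvent_injective hA hxy)

theorem domain_le_HOne : A.domain ≤ HOne hA := fun u hu =>
  (mem_HOne hA).mpr ⟨sqrtResolvent hA (shift A ⟨u, hu⟩), by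
    rw [sqrtResolvent_sqrtResolvent, resolvent_shift]⟩

theorem innerOne_eq {x y : H} {f h : HOne hA} (hx : sqrtResolvent hA x = f)
    (hy : sqrtResolvent hA y = h) : innerOne hA f h = inner ℂ y x :=
  congrArg₂ (inner ℂ) (sqrtShift_eq hA y h hy) (sqrtShift_eq hA x f hx)

theorem innerOne_add_left (f g h : HOne hA) :
    innerOne hA (f + g) h = innerOne hA f h + innerOne hA g h := by
  obtain ⟨x, hx⟩ := (mem_HOne hA).mp f.2
  obtain ⟨y, hy⟩ := (mem_HOne hA).mp g.2
  obtain ⟨z, hz⟩ := (mem_HOne hA).mp h.2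
  rw [innerOne_eq hA hx hz, innerOne_eq hA hy hz, ← inner_add_right,
    innerOne_eq hA (x := x + y) (by rw [map_add, hx, hy, Submodule.coe_add]) hz]

/-- On 𝒟(A) the ℌ₁ inner product with h = (𝔸 + I)⁻¹ψ is thus the pairing with ψ, so the
admissibility identity is automatic there. -/
theorem innerOne_domain (u : A.domain) (f h : HOne hA) (hf : (f : H) = u) :
    innerOne hA f h = inner ℂ (h : H) (shift A u) := by
  obtain ⟨z, hz⟩ := (mem_HOne hA).mp h.2
  have hu : sqrtResolvent hA (sqrtResolvent hA (shift A u)) = f := by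
    rw [sqrtResolvent_sqrtResolvent, resolvent_shift, hf]
  rw [innerOne_eq hA hu hz, ← inner_sqrtResolvent_left, hz]

/-! ### The extended resolvent -/

theorem extResolvent_toRenormedCompletion (x : H) :
    extResolvent hA (toRenormedCompletion (resolvent hA) x) = resolvent hA x :=
  extendOp_toRenormedCompletion (resolvent hA) x

theorem extResolvent_injective : Function.Injective (extResolvent hA) :=
  extendOp_injective (resolvent hA)

/-- Turns the condition span{ψ_j} ∩ H = 0 into N ∩ 𝒟(A) = 0. -/
theorem mem_rangeH_of_extResolvent_mem {ψ : HMinusTwo hA} (h : extResolvent hA ψ ∈ A.domain) :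
    ψ ∈ rangeH hA := by
  refine ⟨shift A ⟨_, h⟩, extResolvent_injective hA ?_⟩
  rw [extResolvent_toRenormedCompletion, resolvent_shift]

/-- The continuous extension to `ℌ₋₁(A)` of the embedding of `H` into `ℌ₋₂(A)`. -/
noncomputable def embedMinusOne : HMinusOne hA →L[ℂ] HMinusTwo hA :=
  (toRenormedCompletion (resolvent hA)).extendOfNorm (toRenormedCompletion (sqrtResolvent hA))

theorem embedMinusOne_toRenormedCompletion (u : H) :
    embedMinusOne hA (toRenormedCompletion (sqrtResolvent hA) u) =
      toRenormedCompletion (resolvent hA) u := by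
  refine LinearMap.extendOfNorm_eq (f := toRenormedCompletion (resolvent hA))
    (e := toRenormedCompletion (sqrtResolvent hA))
    (denseRange_toRenormedCompletion (sqrtResolvent hA)) ⟨‖sqrtResolvent hA‖, fun x => ?_⟩ u
  rw [norm_toRenormedCompletion, norm_toRenormedCompletion, ← sqrtResolvent_sqrtResolvent]
  exact (sqrtResolvent hA).le_opNorm _

theorem extResolvent_embedMinusOne (φ : HMinusOne hA) :
    extResolvent hA (embedMinusOne hA φ) =
      sqrtResolvent hA (extendOp (sqrtResolvent hA) φ) := by
  refine (denseRange_toRenormedCompletion (sqrtResolvent hA)).induction_on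
    (p := fun φ => extResolvent hA (embedMinusOne hA φ) =
      sqrtResolvent hA (extendOp (sqrtResolvent hA) φ)) φ
    (isClosed_eq ((extResolvent hA).continuous.comp (embedMinusOne hA).continuous)
      ((sqrtResolvent hA).continuous.comp (extendOp _).continuous)) fun u => ?_
  rw [embedMinusOne_toRenormedCompletion, extendOp_toRenormedCompletion,
    extResolvent_toRenormedCompletion, sqrtResolvent_sqrtResolvent]

/-- `ψ ∈ ℌ₋₁(A)` if and only if `(𝔸 + I)⁻¹ ψ ∈ ℌ₁(A)`. -/
theorem mem_rangeHMinusOne_iff (ψ : HMinusTwo hA) :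
    ψ ∈ rangeHMinusOne hA ↔ extResolvent hA ψ ∈ HOne hA := by
  rw [mem_HOne]
  constructor
  · rintro ⟨φ, rfl⟩
    exact ⟨_, (extResolvent_embedMinusOne hA φ).symm⟩
  · rintro ⟨g, hg⟩
    -- The extension of (A + I)^(-1/2) is an isometry of ℌ₋₁ onto H, so g comes from some φ.
    obtain ⟨φ, rfl⟩ := extendOp_surjective _ (denseRange_sqrtResolvent hA) g
    exact ⟨φ, extResolvent_injective hA ((extResolvent_embedMinusOne hA φ).trans hg)⟩

end

section

variable {H : Type*} [NormedAddCommGroup H] [InnerProductSpace ℂ H]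
variable [CompleteSpace H] {A : H →ₗ.[ℂ] H} (hA : IsNonnegSelfAdjoint A)
  {n : ℕ} (ψ : Fin n → HMinusTwo hA)

/-! ### The defect vectors -/

/-- The map `α ↦ ∑ p, α_p h_p`. -/
noncomputable def defectMap : (Fin n → ℂ) →ₗ[ℂ] H :=
  Fintype.linearCombination ℂ (defectVec hA ψ)

theorem defectMap_apply (α : Fin n → ℂ) : defectMap hA ψ α = ∑ p, α p • defectVec hA ψ p := rfl

theorem decomposes_iff {f : H} {u : A.domain} {α : Fin n → ℂ} :
    Decomposes hA ψ f u α ↔ f = u + defectMap hA ψ α := Iff.rfl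

theorem extResolvent_sum (c : Fin n → ℂ) :
    extResolvent hA (∑ j, c j • ψ j) = defectMap hA ψ c := by
  simp only [map_sum, map_smul, defectMap_apply, defectVec]

theorem pairing_apply (φ : HMinusTwo hA) (u : A.domain) :
    pairing hA φ u = inner ℂ (extResolvent hA φ) (shift A u) := rfl

theorem inner_defectMap_shift (c : Fin n → ℂ) (u : A.domain) :
    inner ℂ (defectMap hA ψ c) (shift A u) = ∑ j, star (c j) * pairing hA (ψ j) u := by
  rw [defectMap_apply, sum_inner]
  refine Finset.sum_congr rfl fun j _ => ?_
  rw [inner_smul_left]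
  rfl

/-- Identifies the range of A_sym + I with Nᗮ. -/
theorem shift_mem_orthogonal_iff (u : A.domain) :
    shift A u ∈ (LinearMap.range (defectMap hA ψ))ᗮ ↔ ∀ j, pairing hA (ψ j) u = 0 := by
  rw [Submodule.mem_orthogonal]
  constructor
  · intro h j
    refine h _ ⟨Pi.single j 1, ?_⟩
    rw [defectMap, Fintype.linearCombination_apply_single, one_smul]
    rfl
  · rintro h _ ⟨c, rfl⟩
    rw [inner_defectMap_shift]
    simp [h]

theorem mem_symOp_domain {f : H} :
    f ∈ (symOp hA ψ).domain ↔ ∃ u : A.domain, (u : H) = f ∧ ∀ j, pairing hA (ψ j) u = 0 := by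
  rw [symOp, LinearPMap.domRestrict_domain, Submodule.mem_inf]
  constructor
  · rintro ⟨⟨u, hu, rfl⟩, _⟩
    exact ⟨u, rfl, by simpa using hu⟩
  · rintro ⟨u, rfl, hu⟩
    exact ⟨⟨u, by simpa using hu, rfl⟩, u.2⟩

theorem symOp_apply (v : (symOp hA ψ).domain) (u : A.domain) (h : (v : H) = u) :
    symOp hA ψ v = A u :=
  (symOp_le hA ψ).2 h

theorem resolvent_mem_symOp_domain {x : H} (hx : x ∈ (LinearMap.range (defectMap hA ψ))ᗮ) :
    resolvent hA x ∈ (symOp hA ψ).domain := by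
  obtain ⟨u, hu, rfl⟩ := exists_shift_resolvent hA x
  exact (mem_symOp_domain hA ψ).mpr ⟨u, hu, (shift_mem_orthogonal_iff hA ψ u).mp hx⟩

theorem inner_shift_comm (hA : IsNonnegSelfAdjoint A) (u v : A.domain) :
    inner ℂ (shift A u) (v : H) = inner ℂ (u : H) (shift A v) := by
  rw [← resolvent_shift hA v, ← inner_resolvent_left, resolvent_shift]

/-! ### Density of 𝒟(A_sym) and the splitting of 𝒟(A_sym†) -/

section Decomposition

variable {hA ψ}

theorem linearIndependent_defectVec (hψ : LinearIndependent ℂ ψ) :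
    LinearIndependent ℂ (defectVec hA ψ) :=
  hψ.map' (extResolvent hA).toLinearMap (LinearMap.ker_eq_bot.mpr (extResolvent_injective hA))

-- The Gram matrix of the independent h_j is invertible, so u can be sought with (A + I)u ∈ N.
open scoped ComplexOrder in
theorem exists_pairing_eq (hψ : LinearIndependent ℂ ψ) (β : Fin n → ℂ) :
    ∃ u : A.domain, ∀ j, pairing hA (ψ j) u = β j := by
  have hG := (Matrix.posDef_gram_of_linearIndependent (𝕜 := ℂ)
    (linearIndependent_defectVec hψ)).isUnit
  obtain ⟨a, ha⟩ := (Matrix.mulVec_surjective_iff_isUnit.mpr hG) β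
  obtain ⟨u, hu⟩ := shift_surjective hA (defectMap hA ψ a)
  refine ⟨u, fun j => ?_⟩
  rw [← ha, pairing_apply, hu, defectMap_apply, inner_sum]
  simp [Matrix.mulVec, dotProduct, Matrix.gram_apply, inner_smul_right, mul_comm, defectVec]

theorem defectMap_eq_zero_of_mem (hX : Submodule.span ℂ (Set.range ψ) ⊓ rangeH hA = ⊥)
    {c : Fin n → ℂ} (h : defectMap hA ψ c ∈ A.domain) :
    defectMap hA ψ c = 0 := by
  rw [← extResolvent_sum] at h ⊢
  have hm : ∑ j, c j • ψ j ∈ Submodule.span ℂ (Set.range ψ) ⊓ rangeH hA :=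
    ⟨Submodule.sum_mem _ fun j _ => Submodule.smul_mem _ _ (Submodule.subset_span ⟨j, rfl⟩),
      mem_rangeH_of_extResolvent_mem hA h⟩
  rw [hX, Submodule.mem_bot] at hm
  rw [hm, map_zero]

/-- If v is orthogonal to 𝒟(A_sym) = (A + I)⁻¹Nᗮ, then (A + I)⁻¹v lies in Nᗮᗮ = N and in 𝒟(A), hence
is zero. -/
theorem dense_symOp_domain (hX : Submodule.span ℂ (Set.range ψ) ⊓ rangeH hA = ⊥) :
    Dense ((symOp hA ψ).domain : Set H) := by
  rw [Submodule.dense_iff_topologicalClosure_eq_top, Submodule.topologicalClosure_eq_top_iff,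
    Submodule.eq_bot_iff]
  intro v hv
  have hN : resolvent hA v ∈ LinearMap.range (defectMap hA ψ) := by
    rw [← Submodule.orthogonal_orthogonal (LinearMap.range (defectMap hA ψ)),
      Submodule.mem_orthogonal']
    intro x hx
    rw [inner_resolvent_left]
    exact Submodule.inner_left_of_mem_orthogonal (resolvent_mem_symOp_domain hA ψ hx) hv
  obtain ⟨c, hc⟩ := hN
  obtain ⟨u, hu, -⟩ := exists_shift_resolvent hA v
  have h0 := defectMap_eq_zero_of_mem hX (c := c) (by rw [hc, ← hu]; exact u.2)
  exact resolvent_injective hA (by rw [map_zero, ← hc, h0])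

/-- A_sym† + I annihilates N and extends A + I. -/
theorem mem_adjoint_domain_of_eq (hX : Submodule.span ℂ (Set.range ψ) ⊓ rangeH hA = ⊥)
    {f : H} {u : A.domain} {α : Fin n → ℂ}
    (h : f = u + defectMap hA ψ α) :
    ∃ hf : f ∈ (symOp hA ψ).adjoint.domain, (symOp hA ψ).adjoint ⟨f, hf⟩ + f = shift A u := by
  have key : ∀ v : (symOp hA ψ).domain,
      inner ℂ (shift A u - f) (v : H) = inner ℂ f (symOp hA ψ v) := by
    intro v
    obtain ⟨w, hw, hw'⟩ := (mem_symOp_domain hA ψ).mp v.2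
    have h1 : inner ℂ (defectMap hA ψ α) (shift A w) = 0 := by
      rw [inner_defectMap_shift]; simp [hw']
    have h2 := inner_shift_comm hA u w
    rw [symOp_apply hA ψ v w hw.symm, ← hw, inner_sub_left, h2, sub_eq_iff_eq_add,
      ← inner_add_right, ← shift_apply, h, inner_add_left, h1, add_zero]
  have hf := LinearPMap.mem_adjoint_domain_of_exists (T := symOp hA ψ) f ⟨_, key⟩
  refine ⟨hf, ?_⟩
  rw [LinearPMap.adjoint_apply_eq (dense_symOp_domain hX) ⟨f, hf⟩ key, sub_add_cancel]

theorem exists_decomposition (hX : Submodule.span ℂ (Set.range ψ) ⊓ rangeH hA = ⊥)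
    {f : H} (hf : f ∈ (symOp hA ψ).adjoint.domain) :
    ∃ (u : A.domain) (α : Fin n → ℂ), f = u + defectMap hA ψ α := by
  -- With this u, f - u is in the kernel of A_sym† + I, hence orthogonal to Nᗮ.
  obtain ⟨u, hu⟩ := shift_surjective hA ((symOp hA ψ).adjoint ⟨f, hf⟩ + f)
  have hN : f - u ∈ LinearMap.range (defectMap hA ψ) := by
    rw [← Submodule.orthogonal_orthogonal (LinearMap.range (defectMap hA ψ)),
      Submodule.mem_orthogonal']
    intro x hx
    obtain ⟨w, hw, rfl⟩ := exists_shift_resolvent hA x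
    have hw' : (w : H) ∈ (symOp hA ψ).domain := hw ▸ resolvent_mem_symOp_domain hA ψ hx
    have h1 := LinearPMap.adjoint_isFormalAdjoint (dense_symOp_domain hX) ⟨f, hf⟩ ⟨w, hw'⟩
    rw [symOp_apply hA ψ ⟨w, hw'⟩ w rfl] at h1
    have h2 := inner_shift_comm hA u w
    rw [hu, inner_add_left] at h2
    rw [inner_sub_left, ← h2, shift_apply, inner_add_right]
    simp only at h1
    rw [h1, sub_self]
  obtain ⟨α, hα⟩ := hN
  exact ⟨u, α, by rw [hα]; abel⟩

end Decomposition

/-! ### The closure of the form of `A_sym` -/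

/-- The vector (A + I)^(1/2)u is written (A + I)^(-1/2)(A + I)u; its norm is the form norm, so
convergence in the form and in H together is convergence in ℌ₁. -/
theorem norm_sq_sqrtResolvent_shift (u : A.domain) :
    ‖sqrtResolvent hA (shift A u)‖ ^ 2 = (inner ℂ (u : H) (A u)).re + ‖(u : H)‖ ^ 2 := by
  rw [← inner_self_eq_norm_sq (𝕜 := ℂ), inner_sqrtResolvent_left, sqrtResolvent_sqrtResolvent,
    resolvent_shift, ← inner_conj_symm, shift_apply, inner_add_right, map_add, map_add,
    ← inner_self_eq_norm_sq (𝕜 := ℂ)]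
  simp [inner_re_symm (𝕜 := ℂ)]

/-- The form domain of `A_sym` is the orthogonal complement in `ℌ₁(A)` of the defect vectors lying
in `ℌ₁(A)`. -/
theorem mem_formDomain_symOp_iff {f : H} :
    f ∈ formDomain (symOp hA ψ) (symOp_nonneg hA ψ) ↔
      ∃ hf : f ∈ HOne hA, ∀ h : HOne hA, (h : H) ∈ LinearMap.range (defectMap hA ψ) →
        innerOne hA ⟨f, hf⟩ h = 0 := by
  constructor
  · rintro ⟨u, hu, hu'⟩
    choose w hw hw' using fun k => (mem_symOp_domain hA ψ).mp (u k).2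
    have hd : ∀ p q, dist (sqrtResolvent hA (shift A (w p))) (sqrtResolvent hA (shift A (w q))) =
        √((inner ℂ ((u p - u q : (symOp hA ψ).domain) : H) (symOp hA ψ (u p - u q))).re
          + dist (u p : H) (u q) ^ 2) := by
      intro p q
      rw [symOp_apply hA ψ (u p - u q) (w p - w q) (by simp [hw]), dist_eq_norm, dist_eq_norm,
        ← map_sub, ← map_sub, ← Real.sqrt_sq (norm_nonneg _), norm_sq_sqrtResolvent_shift]
      simp [hw]
    have hc : CauchySeq fun k => sqrtResolvent hA (shift A (w k)) := by
      rw [cauchySeq_iff_tendsto_dist_atTop_0]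
      simp only [hd]
      have := (cauchySeq_iff_tendsto_dist_atTop_0.mp hu.cauchySeq).pow 2
      simpa using (hu'.add this).sqrt
    obtain ⟨y, hy⟩ := cauchySeq_tendsto_of_complete hc
    have hfy : sqrtResolvent hA y = f := by
      refine tendsto_nhds_unique (((sqrtResolvent hA).continuous.tendsto y).comp hy) ?_
      convert hu using 2 with k
      rw [Function.comp_apply, sqrtResolvent_sqrtResolvent, resolvent_shift, hw]
    refine ⟨(mem_HOne hA).mpr ⟨y, hfy⟩, fun h hh => ?_⟩
    obtain ⟨z, hz⟩ := (mem_HOne hA).mp h.2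
    rw [innerOne_eq hA hfy hz]
    refine tendsto_nhds_unique (tendsto_const_nhds.inner hy) ?_
    have h0 : ∀ k, inner ℂ z (sqrtResolvent hA (shift A (w k))) = 0 := fun k => by
      rw [← inner_sqrtResolvent_left, hz]
      exact Submodule.inner_right_of_mem_orthogonal hh
        ((shift_mem_orthogonal_iff hA ψ _).mpr (hw' k))
    simp only [h0, tendsto_const_nhds]
  · rintro ⟨hf, h⟩
    obtain ⟨y, hy⟩ := (mem_HOne hA).mp hf
    -- The mapped subspace is (A + I)^(1/2)𝒟(A_sym). A vector v is orthogonal to it only if (A +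
    -- I)^(-1/2)v ∈ Nᗮᗮ = N, and y is orthogonal to such v by hypothesis.
    have hcl : y ∈ (((LinearMap.range (defectMap hA ψ))ᗮ).map
        (sqrtResolvent hA).toLinearMap).topologicalClosure := by
      rw [← Submodule.orthogonal_orthogonal_eq_closure, Submodule.mem_orthogonal]
      intro v hv
      have hN : sqrtResolvent hA v ∈ LinearMap.range (defectMap hA ψ) := by
        rw [← Submodule.orthogonal_orthogonal (LinearMap.range (defectMap hA ψ)),
          Submodule.mem_orthogonal']
        intro x hx
        rw [inner_sqrtResolvent_left]
        exact Submodule.inner_left_of_mem_orthogonal (Submodule.mem_map_of_mem hx) hv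
      rw [← h ⟨_, (mem_HOne hA).mpr ⟨v, rfl⟩⟩ hN]
      exact (innerOne_eq hA hy rfl).symm
    obtain ⟨s, hs, hs'⟩ := mem_closure_iff_seq_limit.mp hcl
    choose x hx hx' using hs
    choose w hw hw' using fun k => exists_shift_resolvent hA (x k)
    have hsw : ∀ k, s k = sqrtResolvent hA (shift A (w k)) := fun k => by rw [hw', ← hx' k]; rfl
    have hmem : ∀ k, (w k : H) ∈ (symOp hA ψ).domain := fun k => by
      rw [hw]; exact resolvent_mem_symOp_domain hA ψ (hx k)
    refine ⟨fun k => ⟨w k, hmem k⟩, ?_, ?_⟩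
    · have := ((sqrtResolvent hA).continuous.tendsto y).comp hs'
      rw [hy] at this
      convert this using 2 with k
      rw [Function.comp_apply, hsw, sqrtResolvent_sqrtResolvent, resolvent_shift]
    · have hlim := (cauchySeq_iff_tendsto_dist_atTop_0.mp hs'.cauchySeq).pow 2
      rw [zero_pow two_ne_zero] at hlim
      refine squeeze_zero (fun p => symOp_nonneg hA ψ _) (fun p => ?_) hlim
      rw [symOp_apply hA ψ _ (w p.1 - w p.2) rfl, dist_eq_norm, hsw, hsw, ← map_sub, ← map_sub,
        norm_sq_sqrtResolvent_shift]
      exact le_add_of_nonneg_right (sq_nonneg _)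

end

section

variable {H : Type*} [NormedAddCommGroup H] [InnerProductSpace ℂ H]
variable [CompleteSpace H] {A : H →ₗ.[ℂ] H} {hA : IsNonnegSelfAdjoint A}
  {n : ℕ} {ψ : Fin n → HMinusTwo hA}

/-! ### Self-adjoint extensions of `A_sym` -/

theorem le_adjoint_of_isSelfAdjoint {S B : H →ₗ.[ℂ] H} (hS : Dense (S.domain : Set H))
    (hB : IsSelfAdjoint B) (h : S ≤ B) : B ≤ S.adjoint := by
  refine LinearPMap.IsFormalAdjoint.le_adjoint hS fun x y => ?_
  have hB' := LinearPMap.adjoint_isFormalAdjoint hB.dense_domain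
  rw [LinearPMap.isSelfAdjoint_def.mp hB] at hB'
  rw [h.2 (x := x) (y := ⟨x, h.1 x.2⟩) rfl]
  exact hB' ⟨x, h.1 x.2⟩ y

theorem domain_le_adjoint_domain (hX : Submodule.span ℂ (Set.range ψ) ⊓ rangeH hA = ⊥) :
    A.domain ≤ (symOp hA ψ).adjoint.domain := fun u hu =>
  (mem_adjoint_domain_of_eq hX (u := ⟨u, hu⟩) (α := 0) (by simp)).1

/-- Green's identity on the domain of a self-adjoint extension of `A_sym`. -/
theorem inner_defectMap_shift_comm (hX : Submodule.span ℂ (Set.range ψ) ⊓ rangeH hA = ⊥)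
    {B : H →ₗ.[ℂ] H} (hB : IsSelfAdjoint B) (hext : symOp hA ψ ≤ B) {u v : A.domain}
    {α β : Fin n → ℂ} (hu : u + defectMap hA ψ α ∈ B.domain)
    (hv : v + defectMap hA ψ β ∈ B.domain) :
    inner ℂ (defectMap hA ψ α) (shift A v) = inner ℂ (shift A u) (defectMap hA ψ β) := by
  have hle := le_adjoint_of_isSelfAdjoint (dense_symOp_domain hX) hB hext
  have hB' := LinearPMap.adjoint_isFormalAdjoint hB.dense_domain
  rw [LinearPMap.isSelfAdjoint_def.mp hB] at hB'
  have key : ∀ {w : A.domain} {γ : Fin n → ℂ} (hw : w + defectMap hA ψ γ ∈ B.domain),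
      B ⟨_, hw⟩ = shift A w - (w + defectMap hA ψ γ) := by
    intro w γ hw
    obtain ⟨hf, h⟩ := mem_adjoint_domain_of_eq hX (u := w) (α := γ) rfl
    rw [hle.2 (x := ⟨_, hw⟩) (y := ⟨_, hf⟩) rfl, ← h, add_sub_cancel_right]
  have h := hB' ⟨_, hu⟩ ⟨_, hv⟩
  rw [key hu, key hv, inner_sub_left, inner_sub_right, sub_left_inj, inner_add_left,
    inner_add_right, inner_shift_comm hA] at h
  exact (add_left_cancel h).symm

/-- Shows 𝒟(A) ∩ 𝒟(B) ⊆ 𝒟(A_sym). By transversality every h ∈ N completes to some -v + h ∈ 𝒟(B), and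
Green's identity against u, which has no defect part, leaves (h, (A + I)u) = 0. -/
theorem pairing_eq_zero_of_mem (hX : Submodule.span ℂ (Set.range ψ) ⊓ rangeH hA = ⊥)
    {B : H →ₗ.[ℂ] H} (hB : IsSelfAdjoint B) (hext : symOp hA ψ ≤ B)
    (hT : Transversal (symOp hA ψ) A B) {u : A.domain} (hu : (u : H) ∈ B.domain) (j : Fin n) :
    pairing hA (ψ j) u = 0 := by
  revert j
  rw [← shift_mem_orthogonal_iff, Submodule.mem_orthogonal]
  rintro _ ⟨α, rfl⟩
  have hα := (mem_adjoint_domain_of_eq hX (u := 0) (α := α) rfl).1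
  rw [← hT] at hα
  obtain ⟨v, hv, g, hg, h⟩ := Submodule.mem_sup.mp hα
  have hg' : ((-⟨v, hv⟩ : A.domain) : H) + defectMap hA ψ α = g := by
    rw [ZeroMemClass.coe_zero, zero_add] at h
    rw [← h]; simp
  rw [inner_defectMap_shift_comm hX hB hext (hg' ▸ hg) (β := 0) (by simpa using hu)]
  simp

theorem extPairing_sub (R : Matrix (Fin n) (Fin n) ℂ) (j : Fin n) (u v : A.domain)
    (α : Fin n → ℂ) :
    extPairing hA ψ R j (u - v) α = extPairing hA ψ R j u α - pairing hA (ψ j) v := by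
  rw [extPairing, extPairing, map_sub]; ring

/-! ### The two implications -/

theorem transversal_of_isOperatorOfMatrix (hψ : LinearIndependent ℂ ψ)
    (hX : Submodule.span ℂ (Set.range ψ) ⊓ rangeH hA = ⊥)
    {R : Matrix (Fin n) (Fin n) ℂ} {B : H →ₗ.[ℂ] H} (hB : IsOperatorOfMatrix hA ψ R B) :
    Transversal (symOp hA ψ) A B := by
  refine le_antisymm (sup_le (domain_le_adjoint_domain hX) hB.1.1) fun f hf => ?_
  obtain ⟨u, α, rfl⟩ := exists_decomposition hX hf
  -- Subtracting this v cancels all extended functionals without changing α.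
  obtain ⟨v, hv⟩ := exists_pairing_eq hψ fun j => extPairing hA ψ R j u α
  refine Submodule.mem_sup.mpr ⟨v, v.2, (u - v : A.domain) + defectMap hA ψ α,
    (hB.2 _).mpr ⟨(mem_adjoint_domain_of_eq hX rfl).1, u - v, α, rfl, fun j => ?_⟩, ?_⟩
  · rw [extPairing_sub, hv, sub_self]
  · rw [Submodule.coe_sub]; abel

theorem domain_inf_HOne_le_of_isAdmissibleMatrix {R : Matrix (Fin n) (Fin n) ℂ}
    (hR : IsAdmissibleMatrix hA ψ R) {B : H →ₗ.[ℂ] H} (hB : IsOperatorOfMatrix hA ψ R B) :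
    B.domain ⊓ HOne hA ≤ (friedrichs (symOp hA ψ) (symOp_nonneg hA ψ)).domain := by
  rintro f ⟨hfB, hf⟩
  obtain ⟨hf', u, α, hd, h0⟩ := (hB.2 f).mp hfB
  refine ⟨(mem_formDomain_symOp_iff hA ψ).mpr ⟨hf, ?_⟩, hf'⟩
  rintro ⟨_, hh⟩ ⟨c, rfl⟩
  obtain ⟨hh', h⟩ := hR.2 c
    ((mem_rangeHMinusOne_iff hA _).mpr (by rw [extResolvent_sum]; exact hh))
  have h1 := h f hf' hf u α hd
  simp only [h0, mul_zero, Finset.sum_const_zero, extResolvent_sum] at h1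
  exact h1.symm

theorem exists_isHermitian_isOperatorOfMatrix
    (hX : Submodule.span ℂ (Set.range ψ) ⊓ rangeH hA = ⊥)
    {B : H →ₗ.[ℂ] H} (hB : IsSelfAdjoint B) (hext : symOp hA ψ ≤ B)
    (hT : Transversal (symOp hA ψ) A B) :
    ∃ R : Matrix (Fin n) (Fin n) ℂ, R.IsHermitian ∧ IsOperatorOfMatrix hA ψ R B := by
  have hex : ∀ p : Fin n, ∃ v : A.domain, v + defectMap hA ψ (Pi.single p 1) ∈ B.domain := by
    intro p
    have hα := (mem_adjoint_domain_of_eq hX (u := 0) (α := Pi.single p 1) rfl).1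
    rw [← hT] at hα
    obtain ⟨v, hv, g, hg, h⟩ := Submodule.mem_sup.mp hα
    refine ⟨-⟨v, hv⟩, ?_⟩
    rw [ZeroMemClass.coe_zero, zero_add] at h
    rw [← h]; simpa using hg
  choose v hv using hex
  have hsingle : ∀ p, defectMap hA ψ (Pi.single p 1) = defectVec hA ψ p := fun p => by
    rw [defectMap, Fintype.linearCombination_apply_single, one_smul]
  -- Subtracting the elements α_p(v_p + h_p) of 𝒟(B) removes the defect part, so membership is
  -- decided inside 𝒟(A).
  have hsum : ∀ (u : A.domain) (α : Fin n → ℂ),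
      u + defectMap hA ψ α ∈ B.domain ↔ ((u - ∑ p, α p • v p : A.domain) : H) ∈ B.domain := by
    intro u α
    have hm : ∑ p, α p • ((v p : H) + defectMap hA ψ (Pi.single p 1)) ∈ B.domain :=
      Submodule.sum_mem _ fun p _ => Submodule.smul_mem _ _ (hv p)
    have e : ((u - ∑ p, α p • v p : A.domain) : H) = u + defectMap hA ψ α -
        ∑ p, α p • ((v p : H) + defectMap hA ψ (Pi.single p 1)) := by
      simp only [hsingle, smul_add, Finset.sum_add_distrib, defectMap_apply]
      push_cast
      abel
    rw [e, Submodule.sub_mem_iff_left _ hm]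
  have hpair : ∀ (j : Fin n) (u : A.domain) (α : Fin n → ℂ),
      extPairing hA ψ (Matrix.of fun j p => -pairing hA (ψ j) (v p)) j u α =
        pairing hA (ψ j) (u - ∑ p, α p • v p) := by
    intro j u α
    simp [extPairing, sub_eq_add_neg]
  have hle := le_adjoint_of_isSelfAdjoint (dense_symOp_domain hX) hB hext
  refine ⟨Matrix.of fun j p => -pairing hA (ψ j) (v p), ?_, hle, fun f => ?_⟩
  -- Green's identity for v_p + h_p and v_q + h_q: ⟨ψ_p, v_q⟩ is the conjugate of ⟨ψ_q, v_p⟩.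
  · ext p q
    have h := inner_defectMap_shift_comm hX hB hext (hv p) (hv q)
    rw [hsingle, hsingle, ← inner_conj_symm (shift A (v p))] at h
    rw [Matrix.conjTranspose_apply, Matrix.of_apply, Matrix.of_apply, star_neg]
    exact congrArg Neg.neg h.symm
  · constructor
    · intro hf
      obtain ⟨u, α, rfl⟩ := exists_decomposition hX (hle.1 hf)
      refine ⟨hle.1 hf, u, α, rfl, fun j => ?_⟩
      rw [hpair]
      exact pairing_eq_zero_of_mem hX hB hext hT ((hsum u α).mp hf) j
    · rintro ⟨-, u, α, hd, h0⟩
      rw [(decomposes_iff hA ψ).mp hd, hsum]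
      exact hext.1 ((mem_symOp_domain hA ψ).mpr ⟨_, rfl, fun j => by rw [← hpair, h0]⟩)

/-- Split f = (f - v) + v with v ∈ 𝒟(A) and f - v ∈ 𝒟(B) ∩ ℌ₁. The first term is ℌ₁-orthogonal to h,
and v carries the same values as the extended functionals at f. -/
theorem isAdmissibleMatrix_of_domain_inf_HOne_le (hψ : LinearIndependent ℂ ψ)
    (hX : Submodule.span ℂ (Set.range ψ) ⊓ rangeH hA = ⊥)
    {R : Matrix (Fin n) (Fin n) ℂ} (hR : R.IsHermitian) {B : H →ₗ.[ℂ] H}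
    (hB : IsOperatorOfMatrix hA ψ R B)
    (hF : B.domain ⊓ HOne hA ≤ (friedrichs (symOp hA ψ) (symOp_nonneg hA ψ)).domain) :
    IsAdmissibleMatrix hA ψ R := by
  refine ⟨hR, fun c hc => ?_⟩
  have hh := (mem_rangeHMinusOne_iff hA _).mp hc
  refine ⟨hh, fun f _ hf u α hd => ?_⟩
  obtain ⟨v, hv⟩ := exists_pairing_eq hψ fun j => extPairing hA ψ R j u α
  have hg : f - v ∈ B.domain := by
    refine (hB.2 _).mpr ⟨Submodule.sub_mem _ ‹_› (domain_le_adjoint_domain hX v.2), u - v, α, ?_,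
      fun j => by rw [extPairing_sub, hv, sub_self]⟩
    rw [decomposes_iff, (decomposes_iff hA ψ).mp hd, Submodule.coe_sub]; abel
  have hv1 := domain_le_HOne hA v.2
  obtain ⟨hg1, h0⟩ := (mem_formDomain_symOp_iff hA ψ).mp
    (hF ⟨hg, Submodule.sub_mem _ hf hv1⟩).1
  have h1 := h0 ⟨_, hh⟩ ⟨c, (extResolvent_sum hA ψ c).symm⟩
  have e : (⟨f, hf⟩ : HOne hA) = ⟨f - v, hg1⟩ + ⟨v, hv1⟩ := Subtype.ext (by simp)
  rw [e, innerOne_add_left, h1, zero_add, innerOne_domain hA v _ _ rfl]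
  simp only [extResolvent_sum, inner_defectMap_shift, hv]

end

end SingularPerturbation

open SingularPerturbation
theorem mainTheorem3 {H : Type*} [NormedAddCommGroup H] [InnerProductSpace ℂ H] [CompleteSpace H]
    {A₀ : H →ₗ.[ℂ] H} (hA₀ : IsNonnegSelfAdjoint A₀)
    {n : ℕ} (ψ : Fin n → HMinusTwo hA₀) (hψ : LinearIndependent ℂ ψ)
    (hX : Submodule.span ℂ (Set.range ψ) ⊓ rangeH hA₀ = ⊥)
    (A' : H →ₗ.[ℂ] H) (hA' : IsSelfAdjoint A') (hext : symOp hA₀ ψ ≤ A') :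
    IsAdmissibleOperator hA₀ ψ A' ↔
      Transversal (symOp hA₀ ψ) A₀ A' ∧
        A'.domain ⊓ HOne hA₀ ≤ (friedrichs (symOp hA₀ ψ) (symOp_nonneg hA₀ ψ)).domain := by
  constructor
  · rintro ⟨R, hR, hB⟩
    exact ⟨transversal_of_isOperatorOfMatrix hψ hX hB,
      domain_inf_HOne_le_of_isAdmissibleMatrix hR hB⟩
  · rintro ⟨hT, hF⟩
    obtain ⟨R, hR, hB⟩ := exists_isHermitian_isOperatorOfMatrix hX hA' hext hT
    exact ⟨R, isAdmissibleMatrix_of_domain_inf_HOne_le hψ hX hR hB hF, hB⟩
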